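/- Fix $\mu>0$. For each $N\ge 1$, observe $N$ data streams $X_{nt}$ ($1\le n\le N$, $t=1,2,\dots$). For $1\le\nu<\infty$ and $S\subset\{1,\dots,N\}$ let $P_{\nu,S}$ (expectation $E_{\nu,S}$) be the law under which the $X_{nt}$ are independent $N(\mu_{nt},1)$ with $\mu_{nt}=\mu$ if $n\in S$ and $t\ge\nu$, and $\mu_{nt}=0$ otherwise; let $E_\infty$ be the expectation when all $\mu_{nt}=0$. A stopping rule $T$ is a $(\mathbb N\cup\{\infty\})$-valued stopping time of the filtration generated by the observations, $\mathrm{ARL}(T)=E_\infty T$, and for an integer $m$ $$D_{N,m}(T)=\sup_{1\le\nu<\infty}\ \max_{S:\,\#S=m} E_{\nu,S}(T-\nu+1\mid T\ge\nu)\in[0,\infty]$$ (those $\nu$ for which $T\ge\nu$ has probability $0$ are disregarded). Let $$\rho(\beta,\zeta)=\begin{cases}\beta-\frac{1-\zeta}{2}&\text{if }\frac{1-\zeta}{2}<\beta\le\frac{3(1-\zeta)}{4},\\ (\sqrt{1-\zeta}-\sqrt{1-\zeta-\beta})^2&\text{if }\frac{3(1-\zeta)}{4}<\beta<1-\zeta.\end{cases}$$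 Theorem. Let $\zeta>0$ and $0<\beta<1$. Let $\gamma=\gamma_N\ge1$ satisfy $\log\gamma\sim N^\zeta$ and let the integers $m=m_N\ge0$ satisfy $m\sim N^{1-\beta}$ as $N\to\infty$. For each $N$ let $T=T_N$ be a stopping rule with $\mathrm{ARL}(T)\ge\gamma$. (a) If $\frac{1-\zeta}{2}<\beta<1-\zeta$, then $$\liminf_{N\to\infty}\frac{D_{N,m}(T)}{\log N}\ \ge\ 2\mu^{-2}\rho(\beta,\zeta).$$ (b) If $\beta>1-\zeta$, then $$\liminf_{N\to\infty}\frac{\log D_{N,m}(T)}{\log N}\ \ge\ \beta+\zeta-1.$$ -/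

import Mathlib

open Filter Topology MeasureTheory ProbabilityTheory Asymptotics
open scoped ENNReal

noncomputable section

namespace MultiStream

/-- Sample space of `N` data streams observed at the times `1, 2, 3, …`:
`x (n, t)` is the observation of stream `n` at time `t`. -/
abbrev Path (N : ℕ) : Type := Fin N × ℕ+ → ℝ

/-- The law under which the observations are independent, with `X (n, t) ∼ N(θ (n, t), 1)`. -/
def law {N : ℕ} (θ : Fin N × ℕ+ → ℝ) : Measure (Path N) :=
  Measure.infinitePi fun i => gaussianReal (θ i) 1

/-- No change: all observations are standard normal. -/
def lawNoChange (N : ℕ) : Measure (Path N) :=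
  law fun _ => 0

/-- The streams in `S` have mean `μ` at and after time `ν`;
all other observations have mean zero. -/
def lawChange {N : ℕ} (μ : ℝ) (ν : ℕ+) (S : Finset (Fin N)) : Measure (Path N) :=
  law fun i => if i.1 ∈ S ∧ ν ≤ i.2 then μ else 0

/-- The information available at time `t`: the σ-algebra generated by all observations
at times `1, …, t` (trivial for `t = 0`). -/
def observations (N : ℕ) : Filtration ℕ (inferInstance : MeasurableSpace (Path N)) where
  seq t := ⨆ (i : Fin N × ℕ+) (_ : (i.2 : ℕ) ≤ t),
    MeasurableSpace.comap (fun x : Path N => x i) inferInstance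
  mono' _ _ hst := iSup_mono fun _ => iSup_mono' fun h => ⟨h.trans hst, le_rfl⟩
  le' _ := iSup₂_le fun i _ => (measurable_pi_apply i).comap_le

/-- A stopping rule: a time in `{0, 1, 2, …} ∪ {∞}` such that `T ≤ t` is decided by the
observations up to time `t`. -/
def IsStoppingRule {N : ℕ} (T : Path N → ℕ∞) : Prop :=
  IsStoppingTime (observations N) T

/-- The average run length: expectation of `T` when there is no change. -/
def ARL {N : ℕ} (T : Path N → ℕ∞) : ℝ≥0∞ :=
  ∫⁻ x, (T x : ℝ≥0∞) ∂(lawNoChange N)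

/-- The conditional expected delay `E (T - ν + 1 ∣ T ≥ ν)` under a change at time `ν` in the
streams of `S`. The subtraction is only evaluated where `ν ≤ T`; if `T ≥ ν` has
probability zero, the value is `0`, so that such `ν` do not contribute to the supremum below. -/
def delay {N : ℕ} (μ : ℝ) (T : Path N → ℕ∞) (ν : ℕ+) (S : Finset (Fin N)) : ℝ≥0∞ :=
  ∫⁻ x, ((T x : ℝ≥0∞) - ((ν : ℕ) : ℝ≥0∞) + 1)
    ∂((lawChange μ ν S)[|{x | ((ν : ℕ) : ℕ∞) ≤ T x}])

/-- The worst-case detection delay, over all change times and all sets of exactly `m`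
changed streams. -/
def worstDelay {N : ℕ} (μ : ℝ) (m : ℕ) (T : Path N → ℕ∞) : ℝ≥0∞ :=
  ⨆ (ν : ℕ+) (S : Finset (Fin N)) (_ : S.card = m), delay μ T ν S

/-- The constant of the logarithmic lower bound, for `(1 - ζ) / 2 < β < 1 - ζ`. -/
def rho (β ζ : ℝ) : ℝ :=
  if β ≤ 3 * (1 - ζ) / 4 then β - (1 - ζ) / 2
  else (Real.sqrt (1 - ζ) - Real.sqrt (1 - ζ - β)) ^ 2

end MultiStream

end

/-! If the delay is short compared with a window of k steps, the rule must usually stop inside the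
window after a change; a long average run length makes such a stop very improbable without change,
for a suitable start of the window. The two are compared through a likelihood ratio.

A run length of at least γ yields a ν with P_∞(T < ν + k | T ≥ ν) ≤ 2k/γ
(`exists_small_stopping_probability`). After a change at ν, Markov's inequality gives stopping in
[ν, ν + k) with conditional probability at least 1 - D/(k + 1). Since D is a maximum over S, this
survives averaging over sets S containing one stream from each of m disjoint blocks of b streams.
The averaged likelihood ratio L is then a product of m independent block averages, and it is
independent of {T ≥ ν}. A (1 + s)-th moment, 0 < s ≤ 1, suffices to control it: E L^(1+s) ≤ (1 +
b^(-s) exp(k(s + s²)μ²/2))^m (`lintegral_mixtureRatio_rpow_le`). Truncating L at level √γ gives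
`one_le_of_worstDelay_le`: 1 ≤ D/(k+1) + 2k γ^(-1/2) + exp(m b^(-s) exp(k(s + s²)μ²/2) - s log γ /
2).

With b = ⌊N/m⌋, of order N^β, it remains to choose k and s. In (a), k is about y log N and s is
fixed; the last term vanishes if 1 - β - βs + (yμ²/2)(s + s²) < ζ, and the best s gives yμ²/2 < ρ.
In (b), k is about N^y and s = 1/k, which keeps the inner exponential bounded; then N^(1-β) must be
of smaller order than N^(ζ-y), that is y < β + ζ - 1. -/

namespace MultiStream

/-! ### Independence and marginals of infinite product measures. -/

section ProductMeasure

variable {ι : Type*}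

/-- The σ-algebra generated by the coordinates in `I`. -/
@[reducible] def coordSigma (I : Set ι) : MeasurableSpace (ι → ℝ) :=
  ⨆ i ∈ I, MeasurableSpace.comap (fun x : ι → ℝ => x i) inferInstance

lemma coordSigma_le (I : Set ι) : coordSigma I ≤ MeasurableSpace.pi :=
  iSup₂_le fun i _ => (measurable_pi_apply i).comap_le

lemma coordSigma_mono {I J : Set ι} (h : I ⊆ J) : coordSigma I ≤ coordSigma J :=
  biSup_mono h

lemma measurable_coord {I : Set ι} {i : ι} (hi : i ∈ I) :
    Measurable[coordSigma I] (fun x : ι → ℝ => x i) :=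
  measurable_iff_comap_le.2
    (le_iSup₂ (f := fun i (_ : i ∈ I) =>
      MeasurableSpace.comap (fun x : ι → ℝ => x i) inferInstance) i hi)

lemma lintegral_mul_of_disjoint (P : ι → Measure ℝ) [∀ i, IsProbabilityMeasure (P i)]
    {I J : Set ι} (hIJ : Disjoint I J) {f g : (ι → ℝ) → ℝ≥0∞}
    (hf : Measurable[coordSigma I] f) (hg : Measurable[coordSigma J] g) :
    ∫⁻ x, f x * g x ∂(Measure.infinitePi P) =
      (∫⁻ x, f x ∂(Measure.infinitePi P)) * ∫⁻ x, g x ∂(Measure.infinitePi P) := by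
  refine lintegral_mul_eq_lintegral_mul_lintegral_of_independent_measurableSpace
    (coordSigma_le I) (coordSigma_le J) ?_ hf hg
  refine indep_iSup_of_disjoint (fun i => (measurable_pi_apply i).comap_le) ?_ hIJ
  exact iIndepFun_infinitePi (P := P) (X := fun _ x => x) fun _ => measurable_id

lemma lintegral_prod_of_pairwise_disjoint (P : ι → Measure ℝ)
    [∀ i, IsProbabilityMeasure (P i)] {κ : Type*} (s : Finset κ) (I : κ → Set ι)
    (hI : Pairwise fun a b => Disjoint (I a) (I b)) (f : κ → (ι → ℝ) → ℝ≥0∞)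
    (hf : ∀ a, Measurable[coordSigma (I a)] (f a)) :
    ∫⁻ x, ∏ a ∈ s, f a x ∂(Measure.infinitePi P) =
      ∏ a ∈ s, ∫⁻ x, f a x ∂(Measure.infinitePi P) := by
  classical
  induction s using Finset.induction_on with
  | empty => simp
  | insert a s ha ih =>
    simp_rw [Finset.prod_insert ha]
    rw [← ih]
    refine lintegral_mul_of_disjoint P (I := I a) (J := ⋃ b ∈ s, I b) ?_ (hf a) ?_
    · refine Set.disjoint_iUnion₂_right.2 fun b hb => hI ?_
      rintro rfl
      exact ha hb
    · refine Finset.measurable_prod _ fun b hb => ?_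
      exact (hf b).mono (coordSigma_mono (Set.subset_biUnion_of_mem (u := fun b => I b) hb)) le_rfl

lemma lintegral_coord (P : ι → Measure ℝ) [∀ i, IsProbabilityMeasure (P i)] (i : ι)
    {f : ℝ → ℝ≥0∞} (hf : Measurable f) :
    ∫⁻ x, f (x i) ∂(Measure.infinitePi P) = ∫⁻ y, f y ∂(P i) := by
  conv_rhs => rw [← Measure.infinitePi_map_eval P i]
  rw [lintegral_map hf (measurable_pi_apply i)]

/-- An event depending only on the coordinates in `I` is a preimage under restriction to `I`, and
the two marginals on `I` agree. This removes the effect of a change outside the observed times. -/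
lemma infinitePi_apply_congr {P Q : ι → Measure ℝ} [∀ i, IsProbabilityMeasure (P i)]
    [∀ i, IsProbabilityMeasure (Q i)] {I : Set ι} (h : ∀ i ∈ I, P i = Q i)
    {A : Set (ι → ℝ)} (hA : MeasurableSet[coordSigma I] A) :
    Measure.infinitePi P A = Measure.infinitePi Q A := by
  have hsig : coordSigma I = MeasurableSpace.comap I.domRestrict MeasurableSpace.pi := by
    simp only [coordSigma, MeasurableSpace.pi, MeasurableSpace.comap_iSup,
      MeasurableSpace.comap_comp, iSup_subtype]
    rfl
  rw [hsig] at hA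
  obtain ⟨B, hB, rfl⟩ := hA
  have hm : Measurable (I.domRestrict : (ι → ℝ) → (I → ℝ)) :=
    measurable_pi_lambda _ fun i => measurable_pi_apply _
  rw [← Measure.map_apply hm hB, ← Measure.map_apply hm hB,
    Measure.infinitePi_map_restrict', Measure.infinitePi_map_restrict']
  have : (fun i : I => P i) = fun i : I => Q i := funext fun i => h i i.2
  congr 1
  simp_rw [this]

end ProductMeasure

/-! ### Gaussian likelihood ratios. -/

section Gaussian

/-- The density of `N(μ, 1)` with respect to `N(0, 1)`. -/
noncomputable def gaussianRatio (μ x : ℝ) : ℝ≥0∞ := ENNReal.ofReal (Real.exp (μ * x - μ ^ 2 / 2))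

@[fun_prop]
lemma measurable_gaussianRatio (μ : ℝ) : Measurable (gaussianRatio μ) := by
  unfold gaussianRatio
  fun_prop

lemma lintegral_gaussianRatio_rpow (μ p : ℝ) :
    ∫⁻ x, gaussianRatio μ x ^ p ∂(gaussianReal 0 1) =
      ENNReal.ofReal (Real.exp ((p ^ 2 - p) * μ ^ 2 / 2)) := by
  have h : ∀ x, gaussianRatio μ x ^ p =
      ENNReal.ofReal (Real.exp (-(p * μ ^ 2 / 2)) * Real.exp (p * μ * x)) := by
    intro x
    rw [gaussianRatio, ENNReal.ofReal_rpow_of_pos (Real.exp_pos _), ← Real.exp_mul,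
      ← Real.exp_add]
    congr 2
    ring
  simp_rw [h]
  rw [← ofReal_integral_eq_lintegral_ofReal
    ((integrable_exp_mul_gaussianReal _).const_mul _) (ae_of_all _ fun x => by positivity),
    integral_const_mul]
  have := congrFun (mgf_id_gaussianReal (μ := 0) (v := 1)) (p * μ)
  simp only [mgf, id] at this
  rw [this, ← Real.exp_add]
  congr 2
  simp
  ring

lemma gaussianReal_eq_withDensity (μ : ℝ) :
    gaussianReal μ 1 = (gaussianReal 0 1).withDensity (gaussianRatio μ) := by
  rw [gaussianReal_of_var_ne_zero _ one_ne_zero, gaussianReal_of_var_ne_zero _ one_ne_zero,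
    ← withDensity_mul _ (measurable_gaussianPDF _ _) (measurable_gaussianRatio μ)]
  congr 1
  ext x
  simp only [Pi.mul_apply, gaussianPDF, gaussianPDFReal, gaussianRatio]
  rw [← ENNReal.ofReal_mul (by positivity), mul_assoc (_⁻¹), ← Real.exp_add]
  congr 3
  simp
  ring

lemma lintegral_gaussianRatio (μ : ℝ) : ∫⁻ x, gaussianRatio μ x ∂(gaussianReal 0 1) = 1 := by
  simpa using lintegral_gaussianRatio_rpow μ 1

variable {ι : Type*}

/-- Shifting finitely many coordinates leaves a density; a change lasting forever would not, for μ ≠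
0, hence the restriction to finite windows later. The identity is checked on finite-dimensional
rectangles. -/
lemma infinitePi_gaussian_apply [DecidableEq ι] (μ : ℝ) (F : Finset ι)
    {A : Set (ι → ℝ)} (hA : MeasurableSet A) :
    Measure.infinitePi (fun i => gaussianReal (if i ∈ F then μ else 0) 1) A =
      ∫⁻ x in A, ∏ i ∈ F, gaussianRatio μ (x i)
        ∂(Measure.infinitePi fun _ : ι => gaussianReal 0 1) := by
  rw [← withDensity_apply _ hA]
  congr 1
  symm
  apply Measure.eq_infinitePi
  intro s t ht
  have hst : MeasurableSet (Set.pi (s : Set ι) t) :=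
    MeasurableSet.pi s.countable_toSet fun i _ => ht i
  rw [withDensity_apply _ hst, ← lintegral_indicator hst]
  -- Merging indicator and density coordinate by coordinate makes the integrand a product of
  -- independent factors over `s ∪ F`.
  let h : ι → ℝ → ℝ≥0∞ := fun i y =>
    (if i ∈ s then (t i).indicator 1 y else 1) * (if i ∈ F then gaussianRatio μ y else 1)
  have hh : ∀ i, Measurable (h i) := by
    intro i
    refine Measurable.mul ?_ ?_
    · split_ifs
      · exact measurable_one.indicator (ht i)
      · exact measurable_const
    · split_ifs
      · fun_prop
      · exact measurable_const
  have h1 : ∀ x : ι → ℝ, (Set.pi (s : Set ι) t).indicator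
      (fun x => ∏ i ∈ F, gaussianRatio μ (x i)) x = ∏ i ∈ s ∪ F, h i (x i) := by
    intro x
    simp only [h]
    rw [Finset.prod_mul_distrib, Finset.prod_ite_mem, Finset.prod_ite_mem,
      Finset.inter_eq_right.2 Finset.subset_union_left,
      Finset.inter_eq_right.2 Finset.subset_union_right]
    by_cases hx : x ∈ Set.pi (s : Set ι) t
    · rw [Set.indicator_of_mem hx, Finset.prod_eq_one (s := s), one_mul]
      intro i hi
      rw [Set.indicator_of_mem (hx i hi)]
      rfl
    · rw [Set.indicator_of_notMem hx]
      simp only [Set.mem_pi, not_forall] at hx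
      obtain ⟨i, hi, hxi⟩ := hx
      rw [Finset.prod_eq_zero hi (Set.indicator_of_notMem hxi _), zero_mul]
  simp_rw [h1]
  rw [lintegral_prod_of_pairwise_disjoint _ _ (fun i => {i})
    (fun i j hij => Set.disjoint_singleton.2 hij) (fun i x => h i (x i))
    (fun i => (hh i).comp (measurable_coord rfl))]
  have h2 : ∀ i, ∫⁻ x : ι → ℝ, h i (x i) ∂(Measure.infinitePi fun _ : ι => gaussianReal 0 1) =
      if i ∈ s then gaussianReal (if i ∈ F then μ else 0) 1 (t i) else 1 := by
    intro i
    rw [lintegral_coord (fun _ => gaussianReal 0 1) i (hh i)]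
    simp only [h]
    have h3 : ∀ y, (t i).indicator 1 y * (if i ∈ F then gaussianRatio μ y else 1) =
        (t i).indicator (fun y => if i ∈ F then gaussianRatio μ y else 1) y := by
      intro y
      by_cases hy : y ∈ t i <;> simp [hy]
    by_cases hs : i ∈ s
    · simp only [hs, if_true, h3]
      rw [lintegral_indicator (ht i)]
      by_cases hF : i ∈ F
      · simp only [hF, if_true]
        rw [← withDensity_apply _ (ht i), ← gaussianReal_eq_withDensity]
      · simp [hF]
    · by_cases hF : i ∈ F
      · simp [hs, hF, lintegral_gaussianRatio]
      · simp [hs, hF]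
  simp_rw [h2]
  rw [Finset.prod_ite_mem, Finset.inter_eq_right.2 Finset.subset_union_left]

end Gaussian

/-! ### Moments of order 1 + s of averages of independent variables. -/

section Moments

lemma rpow_le_mul_add {s : ℝ} (hs0 : 0 < s) (hs1 : s ≤ 1) (y : ℝ≥0∞) :
    y ^ s ≤ ENNReal.ofReal s * y + ENNReal.ofReal (1 - s) := by
  by_cases hy : y = ⊤
  · subst hy
    rw [ENNReal.mul_top (by simpa using hs0)]
    simp
  · lift y to NNReal using hy
    have h := Real.geom_mean_le_arith_mean2_weighted hs0.le (sub_nonneg.2 hs1) y.coe_nonneg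
      zero_le_one (by ring)
    rw [Real.one_rpow, mul_one, mul_one] at h
    rw [← ENNReal.ofReal_coe_nnreal, ENNReal.ofReal_rpow_of_nonneg y.coe_nonneg hs0.le,
      ← ENNReal.ofReal_mul hs0.le, ← ENNReal.ofReal_add (by positivity) (sub_nonneg.2 hs1)]
    exact ENNReal.ofReal_le_ofReal h

lemma lintegral_rpow_le_one {Ω : Type*} [MeasurableSpace Ω] {P : Measure Ω}
    [IsProbabilityMeasure P] {s : ℝ} (hs0 : 0 < s) (hs1 : s ≤ 1) {Y : Ω → ℝ≥0∞}
    (hY : Measurable Y) (h1 : ∫⁻ x, Y x ∂P ≤ 1) : ∫⁻ x, Y x ^ s ∂P ≤ 1 := by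
  calc ∫⁻ x, Y x ^ s ∂P
      ≤ ∫⁻ x, (ENNReal.ofReal s * Y x + ENNReal.ofReal (1 - s)) ∂P :=
        lintegral_mono fun x => rpow_le_mul_add hs0 hs1 _
    _ = ENNReal.ofReal s * ∫⁻ x, Y x ∂P + ENNReal.ofReal (1 - s) := by
        rw [lintegral_add_right _ measurable_const, lintegral_const_mul _ hY]
        simp
    _ ≤ ENNReal.ofReal s * 1 + ENNReal.ofReal (1 - s) := by gcongr
    _ = 1 := by
        rw [mul_one, ← ENNReal.ofReal_add hs0.le (sub_nonneg.2 hs1)]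
        simp

/-- For Y the average, Y^(1+s) = Y · Y^s. Subadditivity of y ↦ y^s separates, in each summand, the
variable's own contribution from that of the others; the others are independent of it, and their
s-th moment is at most 1 since their mean is. -/
lemma lintegral_average_rpow_le {ι κ : Type*} [Fintype κ] [Nonempty κ] (P : ι → Measure ℝ)
    [∀ i, IsProbabilityMeasure (P i)] {s : ℝ} (hs0 : 0 < s) (hs1 : s ≤ 1) (M : ℝ≥0∞)
    (I : κ → Set ι) (hI : Pairwise fun a b => Disjoint (I a) (I b))
    (f : κ → (ι → ℝ) → ℝ≥0∞) (hf : ∀ a, Measurable[coordSigma (I a)] (f a))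
    (h1 : ∀ a, ∫⁻ x, f a x ∂(Measure.infinitePi P) = 1)
    (hM : ∀ a, ∫⁻ x, f a x ^ (1 + s) ∂(Measure.infinitePi P) ≤ M) :
    ∫⁻ x, ((Fintype.card κ : ℝ≥0∞)⁻¹ * ∑ a, f a x) ^ (1 + s) ∂(Measure.infinitePi P) ≤
      1 + ((Fintype.card κ : ℝ≥0∞)⁻¹) ^ s * M := by
  classical
  set b : ℝ≥0∞ := (Fintype.card κ : ℝ≥0∞)⁻¹ with hb
  have hb1 : (Fintype.card κ : ℝ≥0∞) * b = 1 :=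
    ENNReal.mul_inv_cancel (by simp) (by simp)
  have hf' : ∀ a, Measurable (f a) := fun a => (hf a).mono (coordSigma_le _) le_rfl
  have hpt : ∀ x, (b * ∑ a, f a x) ^ (1 + s) ≤
      ∑ a, b * (b ^ s * f a x ^ (1 + s) +
        f a x * (b * ∑ c ∈ Finset.univ.erase a, f c x) ^ s) := by
    intro x
    rw [ENNReal.rpow_add_of_nonneg _ _ zero_le_one hs0.le, ENNReal.rpow_one,
      Finset.mul_sum, Finset.sum_mul]
    refine Finset.sum_le_sum fun a _ => ?_
    rw [mul_assoc]
    gcongr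
    rw [← Finset.mul_sum, ← Finset.add_sum_erase _ _ (Finset.mem_univ a), mul_add]
    calc f a x * (b * f a x + b * ∑ c ∈ Finset.univ.erase a, f c x) ^ s
        ≤ f a x * ((b * f a x) ^ s + (b * ∑ c ∈ Finset.univ.erase a, f c x) ^ s) := by
          gcongr
          exact ENNReal.rpow_add_le_add_rpow _ _ hs0.le hs1
      _ = _ := by
          rw [mul_add, ENNReal.mul_rpow_of_nonneg _ _ hs0.le,
            ENNReal.rpow_add_of_nonneg _ _ zero_le_one hs0.le, ENNReal.rpow_one]
          ring
  have hint : ∀ a, ∫⁻ x, (b ^ s * f a x ^ (1 + s) +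
      f a x * (b * ∑ c ∈ Finset.univ.erase a, f c x) ^ s) ∂(Measure.infinitePi P) ≤
      b ^ s * M + 1 := by
    intro a
    have hm1 : Measurable fun x => b ^ s * f a x ^ (1 + s) :=
      ((hf' a).pow_const _).const_mul _
    rw [lintegral_add_left hm1, lintegral_const_mul _ ((hf' a).pow_const _)]
    refine add_le_add (mul_le_mul_right (hM a) _) ?_
    have hY : Measurable[coordSigma (⋃ c ∈ Finset.univ.erase a, I c)]
        fun x => b * ∑ c ∈ Finset.univ.erase a, f c x := by
      refine Measurable.const_mul (Finset.measurable_sum _ fun c hc => ?_) _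
      exact (hf c).mono (coordSigma_mono
        (Set.subset_biUnion_of_mem (u := fun c => I c) hc)) le_rfl
    rw [lintegral_mul_of_disjoint P
      (Set.disjoint_iUnion₂_right.2 fun c hc => hI (Finset.ne_of_mem_erase hc).symm)
      (hf a) (hY.pow_const s), h1, one_mul]
    refine lintegral_rpow_le_one hs0 hs1 (hY.mono (coordSigma_le _) le_rfl) ?_
    rw [lintegral_const_mul _ (Finset.measurable_sum _ fun c _ => hf' c),
      lintegral_finsetSum _ fun c _ => hf' c]
    simp_rw [h1]
    rw [Finset.sum_const, nsmul_eq_mul, mul_one, mul_comm, ← hb1]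
    gcongr
    exact Finset.card_le_univ _
  calc _ ≤ ∫⁻ x, ∑ a, b * (b ^ s * f a x ^ (1 + s) +
        f a x * (b * ∑ c ∈ Finset.univ.erase a, f c x) ^ s) ∂(Measure.infinitePi P) :=
        lintegral_mono hpt
    _ = ∑ a, b * ∫⁻ x, (b ^ s * f a x ^ (1 + s) +
        f a x * (b * ∑ c ∈ Finset.univ.erase a, f c x) ^ s) ∂(Measure.infinitePi P) := by
        have hm : ∀ a, Measurable fun x => b ^ s * f a x ^ (1 + s) +
            f a x * (b * ∑ c ∈ Finset.univ.erase a, f c x) ^ s := fun a =>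
          (((hf' a).pow_const _).const_mul _).add ((hf' a).mul
            ((Measurable.const_mul (Finset.measurable_sum _ fun c _ => hf' c) _).pow_const _))
        rw [lintegral_finsetSum _ fun a _ => (hm a).const_mul _]
        simp_rw [lintegral_const_mul _ (hm _)]
    _ ≤ ∑ _a : κ, b * (b ^ s * M + 1) := by gcongr with a; exact hint a
    _ = _ := by
        rw [Finset.sum_const, nsmul_eq_mul, ← mul_assoc, Finset.card_univ, hb1, one_mul,
          add_comm]

end Moments

/-! ### The likelihood ratio of a mixture over blocks of streams. -/

section LikelihoodRatio

variable {N : ℕ}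

/-- The likelihood ratio of a change to mean `μ` in stream `n` during the times of `W`. -/
noncomputable def streamRatio (μ : ℝ) (W : Finset ℕ+) (n : Fin N) (x : Path N) : ℝ≥0∞ :=
  ∏ t ∈ W, gaussianRatio μ (x (n, t))

lemma measurable_streamRatio (μ : ℝ) (W : Finset ℕ+) (n : Fin N) :
    Measurable[coordSigma {i : Fin N × ℕ+ | i.1 = n ∧ i.2 ∈ W}] (streamRatio μ W n) := by
  refine Finset.measurable_prod _ fun t ht =>
    Measurable.comp (g := gaussianRatio μ) (f := fun x : Path N => x (n, t))
      (measurable_gaussianRatio μ) ?_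
  exact measurable_coord (I := {i : Fin N × ℕ+ | i.1 = n ∧ i.2 ∈ W}) (i := (n, t)) ⟨rfl, ht⟩

lemma lintegral_streamRatio_rpow (μ : ℝ) (W : Finset ℕ+) (n : Fin N) {p : ℝ} (hp : 0 ≤ p) :
    ∫⁻ x, streamRatio μ W n x ^ p ∂(lawNoChange N) =
      ENNReal.ofReal (Real.exp (W.card * ((p ^ 2 - p) * μ ^ 2 / 2))) := by
  simp_rw [streamRatio, ← ENNReal.prod_rpow_of_nonneg hp]
  rw [lawNoChange, law, lintegral_prod_of_pairwise_disjoint _ W (fun t => {(n, t)})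
    (fun t u htu => Set.disjoint_singleton.2 fun h => htu (Prod.ext_iff.1 h).2)
    (fun t x => gaussianRatio μ (x (n, t)) ^ p)
    (fun t => (Measurable.comp (measurable_gaussianRatio μ)
      (measurable_coord (I := {(n, t)}) (i := (n, t)) rfl)).pow_const p)]
  have : ∀ t : ℕ+, ∫⁻ x : Path N, gaussianRatio μ (x (n, t)) ^ p
      ∂(Measure.infinitePi fun _ : Fin N × ℕ+ => gaussianReal 0 1) =
      ENNReal.ofReal (Real.exp ((p ^ 2 - p) * μ ^ 2 / 2)) := fun t => by
    rw [lintegral_coord (fun _ => gaussianReal 0 1) (n, t)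
      (f := fun y => gaussianRatio μ y ^ p) ((measurable_gaussianRatio μ).pow_const p),
      lintegral_gaussianRatio_rpow]
  simp_rw [this]
  rw [Finset.prod_const, ← ENNReal.ofReal_pow (Real.exp_pos _).le, ← Real.exp_nat_mul]

lemma lintegral_streamRatio (μ : ℝ) (W : Finset ℕ+) (n : Fin N) :
    ∫⁻ x, streamRatio μ W n x ∂(lawNoChange N) = 1 := by
  simpa using lintegral_streamRatio_rpow μ W n zero_le_one

/-- The likelihood ratio of the uniform mixture of changes in one stream of each of `m` blocks,
the blocks being given by `e`. -/
noncomputable def mixtureRatio {m b : ℕ} (μ : ℝ) (W : Finset ℕ+) (e : Fin m × Fin b → Fin N)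
    (x : Path N) : ℝ≥0∞ :=
  ∏ j : Fin m, ((b : ℝ≥0∞)⁻¹ * ∑ i : Fin b, streamRatio μ W (e (j, i)) x)

lemma measurable_blockRatio {m b : ℕ} (μ : ℝ) (W : Finset ℕ+) (e : Fin m × Fin b → Fin N)
    (j : Fin m) :
    Measurable[coordSigma {i : Fin N × ℕ+ | (∃ a, i.1 = e (j, a)) ∧ i.2 ∈ W}]
      fun x => (b : ℝ≥0∞)⁻¹ * ∑ i : Fin b, streamRatio μ W (e (j, i)) x := by
  refine Measurable.const_mul (Finset.measurable_sum _ fun a _ => ?_) _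
  refine (measurable_streamRatio μ W (e (j, a))).mono (coordSigma_mono ?_) le_rfl
  exact fun i hi => ⟨⟨a, hi.1⟩, hi.2⟩

lemma measurable_mixtureRatio {m b : ℕ} (μ : ℝ) (W : Finset ℕ+) (e : Fin m × Fin b → Fin N) :
    Measurable[coordSigma {i : Fin N × ℕ+ | i.2 ∈ W}] (mixtureRatio μ W e) :=
  Finset.measurable_prod _ fun j _ => (measurable_blockRatio μ W e j).mono
    (coordSigma_mono fun _ hi => hi.2) le_rfl

/-- Injectivity of `e` makes the blocks disjoint, so the moment of the product factors into moments
of block averages. -/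
lemma lintegral_mixtureRatio_rpow_le {m b : ℕ} [NeZero b] (μ : ℝ) (W : Finset ℕ+)
    {e : Fin m × Fin b → Fin N} (he : Function.Injective e) {s : ℝ} (hs0 : 0 < s) (hs1 : s ≤ 1) :
    ∫⁻ x, mixtureRatio μ W e x ^ (1 + s) ∂(lawNoChange N) ≤
      (1 + ((b : ℝ≥0∞)⁻¹) ^ s *
        ENNReal.ofReal (Real.exp (W.card * ((s + s ^ 2) * μ ^ 2 / 2)))) ^ m := by
  simp_rw [mixtureRatio, ← ENNReal.prod_rpow_of_nonneg (by linarith : (0 : ℝ) ≤ 1 + s)]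
  rw [lawNoChange, law, lintegral_prod_of_pairwise_disjoint _ Finset.univ
    (fun j : Fin m => {i : Fin N × ℕ+ | (∃ a, i.1 = e (j, a)) ∧ i.2 ∈ W}) ?_
    (fun j x => ((b : ℝ≥0∞)⁻¹ * ∑ i : Fin b, streamRatio μ W (e (j, i)) x) ^ (1 + s))
    (fun j => (measurable_blockRatio μ W e j).pow_const _)]
  · refine (Finset.prod_le_pow_card _ _ (1 + ((b : ℝ≥0∞)⁻¹) ^ s *
      ENNReal.ofReal (Real.exp (W.card * ((s + s ^ 2) * μ ^ 2 / 2))))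
      fun j _ => ?_).trans_eq (by simp)
    have := lintegral_average_rpow_le (κ := Fin b) (fun _ : Fin N × ℕ+ => gaussianReal 0 1)
      hs0 hs1 (ENNReal.ofReal (Real.exp (W.card * ((s + s ^ 2) * μ ^ 2 / 2))))
      (fun a => {i : Fin N × ℕ+ | i.1 = e (j, a) ∧ i.2 ∈ W}) ?_
      (fun a => streamRatio μ W (e (j, a))) (fun a => measurable_streamRatio μ W _)
      (fun a => lintegral_streamRatio μ W _) (fun a => ?_)
    · simpa using this
    · intro a a' haa
      refine Set.disjoint_left.2 fun i hi hi' => haa ?_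
      simpa using he (hi.1.symm.trans hi'.1)
    · refine (lintegral_streamRatio_rpow μ W _ (by linarith)).le.trans_eq ?_
      congr 4
      ring
  · intro j j' hjj
    refine Set.disjoint_left.2 ?_
    rintro i ⟨⟨a, ha⟩, _⟩ ⟨⟨a', ha'⟩, _⟩
    have := he (ha.symm.trans ha')
    simp only [Prod.mk.injEq] at this
    exact hjj this.1

lemma setLIntegral_mixtureRatio {m b : ℕ} (μ : ℝ) (W : Finset ℕ+) (e : Fin m × Fin b → Fin N)
    (A : Set (Path N)) :
    ∫⁻ x in A, mixtureRatio μ W e x ∂(lawNoChange N) =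
      ((b : ℝ≥0∞)⁻¹) ^ m * ∑ f : Fin m → Fin b,
        ∫⁻ x in A, ∏ j, streamRatio μ W (e (j, f j)) x ∂(lawNoChange N) := by
  have hm : ∀ f : Fin m → Fin b,
      Measurable fun x : Path N => ∏ j, streamRatio μ W (e (j, f j)) x := fun f =>
    Finset.measurable_prod _ fun j _ => (measurable_streamRatio μ W _).mono (coordSigma_le _) le_rfl
  rw [← lintegral_finsetSum _ fun f _ => hm f,
    ← lintegral_const_mul _ (Finset.measurable_sum _ fun f _ => hm f)]
  refine lintegral_congr fun x => ?_
  rw [mixtureRatio, Finset.prod_mul_distrib, Finset.prod_univ_sum]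
  simp

/-- A bound valid for every selection `f` holds for the uniform mean over the `b ^ m` selections. -/
lemma le_setLIntegral_mixtureRatio {m b : ℕ} [NeZero b] (μ : ℝ) (W : Finset ℕ+)
    (e : Fin m × Fin b → Fin N) (A : Set (Path N)) (q r : ℝ≥0∞)
    (h : ∀ f : Fin m → Fin b,
      q ≤ r + ∫⁻ x in A, ∏ j, streamRatio μ W (e (j, f j)) x ∂(lawNoChange N)) :
    q ≤ r + ∫⁻ x in A, mixtureRatio μ W e x ∂(lawNoChange N) := by
  have hb : ((b : ℝ≥0∞)⁻¹) ^ m * (b : ℝ≥0∞) ^ m = 1 := by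
    rw [← mul_pow, ENNReal.inv_mul_cancel (by simp [NeZero.ne b]) (by simp), one_pow]
  have hsum : ∀ c : ℝ≥0∞, ((b : ℝ≥0∞)⁻¹) ^ m * ∑ _f : Fin m → Fin b, c = c := fun c => by
    rw [Finset.sum_const, nsmul_eq_mul, ← mul_assoc]
    simp [hb]
  rw [setLIntegral_mixtureRatio, ← hsum q]
  conv_rhs => rw [← hsum r]
  rw [← mul_add, ← Finset.sum_add_distrib]
  gcongr with f
  exact h f

end LikelihoodRatio

variable {N : ℕ}

instance (θ : Fin N × ℕ+ → ℝ) : IsProbabilityMeasure (law θ) := by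
  unfold law
  infer_instance

instance : IsProbabilityMeasure (lawNoChange N) := by
  unfold lawNoChange
  infer_instance

instance (μ : ℝ) (ν : ℕ+) (S : Finset (Fin N)) : IsProbabilityMeasure (lawChange μ ν S) := by
  unfold lawChange
  infer_instance

/-! ### Run length, delay and their nonasymptotic trade-off. -/

section StoppingRule

variable {T : Path N → ℕ∞}

lemma IsStoppingRule.measurableSet_succ_le (hT : IsStoppingRule T) (t : ℕ) :
    MeasurableSet[coordSigma {i : Fin N × ℕ+ | (i.2 : ℕ) ≤ t}]
      {x | ((t + 1 : ℕ) : ℕ∞) ≤ T x} := by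
  have h : MeasurableSet[coordSigma {i : Fin N × ℕ+ | (i.2 : ℕ) ≤ t}] {x | T x ≤ (t : ℕ∞)} := hT t
  have heq : {x | ((t + 1 : ℕ) : ℕ∞) ≤ T x} = {x | T x ≤ (t : ℕ∞)}ᶜ := by
    ext x
    simp only [Set.mem_ofPred_eq, Set.mem_compl_iff, not_le, Nat.cast_add, Nat.cast_one]
    exact ENat.add_one_le_iff (ENat.natCast_ne_top t)
  rw [heq]
  exact h.compl

/-- T ≥ n means that T ≤ n - 1 fails, so it is decided strictly before time n; this yields
independence from a window starting at n. -/
lemma IsStoppingRule.measurableSet_le (hT : IsStoppingRule T) (n : ℕ+) :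
    MeasurableSet[coordSigma {i : Fin N × ℕ+ | i.2 < n}] {x | ((n : ℕ) : ℕ∞) ≤ T x} := by
  have h := hT.measurableSet_succ_le (n - 1 : ℕ)
  rw [show (n - 1 : ℕ) + 1 = n from Nat.sub_add_cancel n.pos] at h
  convert h using 4 with i
  rw [← PNat.coe_lt_coe]
  have := n.pos
  omega

lemma IsStoppingRule.measurableSet_le' (hT : IsStoppingRule T) (n : ℕ+) :
    MeasurableSet {x | ((n : ℕ) : ℕ∞) ≤ T x} :=
  coordSigma_le _ _ (hT.measurableSet_le n)

lemma ARL_eq_tsum (hT : IsStoppingRule T) :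
    ARL T = ∑' n : ℕ, lawNoChange N {x | ((n + 1 : ℕ) : ℕ∞) ≤ T x} := by
  have hm : ∀ n : ℕ, MeasurableSet {x | ((n + 1 : ℕ) : ℕ∞) ≤ T x} := fun n =>
    coordSigma_le _ _ (hT.measurableSet_succ_le n)
  have h : ∀ x, (T x : ℝ≥0∞) =
      ∑' n : ℕ, {x | ((n + 1 : ℕ) : ℕ∞) ≤ T x}.indicator (1 : Path N → ℝ≥0∞) x := by
    intro x
    simp only [Set.indicator_apply, Set.mem_ofPred_eq, Pi.one_apply]
    cases hx : T x with
    | top => simp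
    | coe a =>
      rw [tsum_eq_sum (s := Finset.range a)]
      · rw [Finset.sum_congr rfl fun n hn => if_pos ?_]
        · simp
        · exact_mod_cast Nat.succ_le_of_lt (Finset.mem_range.1 hn)
      · intro n hn
        refine if_neg fun h => hn (Finset.mem_range.2 ?_)
        exact_mod_cast h
  rw [ARL]
  simp_rw [h]
  rw [lintegral_tsum fun n => (measurable_one.indicator (hm n)).aemeasurable]
  simp_rw [lintegral_indicator_one (hm _)]

/-- A rule with a long average run length has, at some time `ν`, a small conditional probability
of stopping within the next `k` steps. -/
lemma exists_small_stopping_probability (hT : IsStoppingRule T) {γ : ℝ} (hγ : 0 < γ)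
    (hARL : ENNReal.ofReal γ ≤ ARL T) (k : ℕ+) :
    ∃ ν : ℕ+, lawNoChange N {x | ((ν : ℕ) : ℕ∞) ≤ T x} ≠ 0 ∧
      lawNoChange N ({x | ((ν : ℕ) : ℕ∞) ≤ T x} \ {x | ((ν + k : ℕ+) : ℕ∞) ≤ T x}) ≤
        ENNReal.ofReal (2 * k / γ) * lawNoChange N {x | ((ν : ℕ) : ℕ∞) ≤ T x} := by
  by_contra! hcon
  set p : ℕ → ℝ := fun n => (lawNoChange N).real {x | ((n + 1 : ℕ) : ℕ∞) ≤ T x} with hp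
  set q : ℝ := 2 * k / γ with hq
  have hk : (0 : ℝ) < k := by exact_mod_cast k.pos
  have hq0 : 0 < q := by positivity
  have hp0 : ∀ n, 0 ≤ p n := fun n => measureReal_nonneg
  have hp1 : ∀ n, p n ≤ 1 := fun n => measureReal_le_one
  -- Under the negated claim every window of k steps loses at least a fraction q of the surviving
  -- probability.
  have hstep : ∀ n, p (n + k) ≤ (1 - q) * p n := by
    intro n
    have hsub : {x | ((n + k + 1 : ℕ) : ℕ∞) ≤ T x} ⊆ {x | ((n + 1 : ℕ) : ℕ∞) ≤ T x} :=
      fun x (hx : _ ≤ T x) => le_trans (Nat.cast_le.2 (by omega)) hx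
    have hm : MeasurableSet {x | ((n + k + 1 : ℕ) : ℕ∞) ≤ T x} :=
      coordSigma_le _ _ (hT.measurableSet_succ_le (n + k))
    have hdiff := measureReal_sdiff (μ := lawNoChange N) hsub hm
    rcases eq_or_ne (p n) 0 with h0 | h0
    · have : p (n + k) ≤ p n := measureReal_mono hsub
      rw [h0] at this ⊢
      linarith
    · have h1 := hcon n.succPNat (fun h => h0 (by
        simp only [hp, measureReal_def]
        rw [ENNReal.toReal_eq_zero_iff]
        exact Or.inl h))
      have h2 := (ENNReal.toReal_mono (measure_ne_top _ _) h1.le)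
      rw [ENNReal.toReal_mul, ENNReal.toReal_ofReal hq0.le] at h2
      have h3 : ((n.succPNat + k : ℕ+) : ℕ) = n + k + 1 := by
        rw [PNat.add_coe, Nat.succPNat_coe, Nat.succ_eq_add_one, add_right_comm]
      rw [h3] at h2
      have h4 : q * p n ≤ p n - p (n + k) := hdiff ▸ h2
      linarith
  -- A partial sum A satisfies A ≤ k + (1 - q)A, so A ≤ k/q = γ/2; the factor 2 in q is what
  -- contradicts a run length of at least γ.
  have hsum : ∀ n, ∑ j ∈ Finset.range n, p j ≤ γ / 2 := by
    intro n
    have h1 : ∑ j ∈ Finset.range n, p j ≤ ∑ j ∈ Finset.range (k + n), p j :=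
      Finset.sum_le_sum_of_subset_of_nonneg (Finset.range_mono (by omega)) fun j _ _ => hp0 j
    have h2 : ∑ j ∈ Finset.range (k + n), p j ≤
        k + (1 - q) * ∑ j ∈ Finset.range n, p j := by
      rw [Finset.sum_range_add, Finset.mul_sum]
      gcongr with j
      · exact (Finset.sum_le_sum fun j _ => hp1 j).trans_eq (by simp)
      · rw [add_comm]
        exact hstep j
    have h3 : q * ∑ j ∈ Finset.range n, p j ≤ k := by linarith
    rw [hq, div_mul_eq_mul_div, div_le_iff₀ hγ] at h3
    nlinarith
  have : ARL T ≤ ENNReal.ofReal (γ / 2) := by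
    rw [ARL_eq_tsum hT, ENNReal.tsum_eq_iSup_nat]
    refine iSup_le fun n => ?_
    refine le_trans (le_of_eq ?_) (ENNReal.ofReal_le_ofReal (hsum n))
    rw [ENNReal.ofReal_sum_of_nonneg fun j _ => hp0 j]
    exact Finset.sum_congr rfl fun j _ => (ofReal_measureReal (measure_ne_top _ _)).symm
  have := (ENNReal.ofReal_le_ofReal_iff (by positivity)).1 (hARL.trans this)
  linarith

lemma lawChange_apply (μ : ℝ) (ν : ℕ+) (S : Finset (Fin N)) (k : ℕ+) {A : Set (Path N)}
    (hA : MeasurableSet[coordSigma {i : Fin N × ℕ+ | i.2 < ν + k}] A) :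
    lawChange μ ν S A =
      ∫⁻ x in A, ∏ n ∈ S, streamRatio μ (Finset.Ico ν (ν + k)) n x ∂(lawNoChange N) := by
  have hA' : MeasurableSet A := coordSigma_le _ _ hA
  have h : ∀ x : Path N, ∏ n ∈ S, streamRatio μ (Finset.Ico ν (ν + k)) n x =
      ∏ i ∈ S ×ˢ Finset.Ico ν (ν + k), gaussianRatio μ (x i) := fun x => by
    rw [Finset.prod_product]
    rfl
  simp_rw [h]
  rw [lawNoChange, law, ← infinitePi_gaussian_apply μ _ hA', lawChange, law]
  refine infinitePi_apply_congr (I := {i : Fin N × ℕ+ | i.2 < ν + k}) ?_ hA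
  intro i hi
  simp only [Set.mem_ofPred_eq] at hi
  simp [hi]

lemma lawChange_le (hT : IsStoppingRule T) (μ : ℝ) (ν : ℕ+) (S : Finset (Fin N)) :
    lawChange μ ν S {x | ((ν : ℕ) : ℕ∞) ≤ T x} =
      lawNoChange N {x | ((ν : ℕ) : ℕ∞) ≤ T x} := by
  refine infinitePi_apply_congr (I := {i : Fin N × ℕ+ | i.2 < ν}) ?_ (hT.measurableSet_le ν)
  intro i hi
  simp only [Set.mem_ofPred_eq] at hi
  simp [not_le.2 hi]

/-- Markov's inequality for the conditional delay. -/
lemma lawNoChange_le_delay_add (hT : IsStoppingRule T) (μ : ℝ) (ν k : ℕ+) (S : Finset (Fin N))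
    (h0 : lawNoChange N {x | ((ν : ℕ) : ℕ∞) ≤ T x} ≠ 0) :
    lawNoChange N {x | ((ν : ℕ) : ℕ∞) ≤ T x} ≤
      delay μ T ν S / (k + 1) * lawNoChange N {x | ((ν : ℕ) : ℕ∞) ≤ T x} +
      lawChange μ ν S ({x | ((ν : ℕ) : ℕ∞) ≤ T x} \ {x | ((ν + k : ℕ+) : ℕ∞) ≤ T x}) := by
  set B := {x | ((ν : ℕ) : ℕ∞) ≤ T x} with hB
  set C := {x | ((ν + k : ℕ+) : ℕ∞) ≤ T x} with hC
  set Q := lawChange μ ν S with hQ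
  have hBm : MeasurableSet B := hT.measurableSet_le' ν
  have hCm : MeasurableSet C := hT.measurableSet_le' (ν + k)
  have hCB : C ⊆ B := fun x (hx : _ ≤ T x) => le_trans (Nat.cast_le.2 (by simp)) hx
  have hQB : Q B = lawNoChange N B := lawChange_le hT μ ν S
  -- On C, T - ν + 1 ≥ k + 1.
  have h1 : ((k : ℝ≥0∞) + 1) * (Q[|B]) C ≤ delay μ T ν S := by
    rw [← setLIntegral_const, ← lintegral_indicator hCm, delay]
    refine lintegral_mono fun x => ?_
    by_cases hx : x ∈ C
    · rw [Set.indicator_of_mem hx]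
      gcongr
      have h2 : (((ν + k : ℕ+) : ℕ∞) : ℝ≥0∞) ≤ T x := ENat.toENNReal_le.2 hx
      rw [ENat.toENNReal_coe] at h2
      refine ENNReal.le_sub_of_add_le_left (by simp) (le_trans (le_of_eq ?_) h2)
      push_cast
      rfl
    · simp [hx]
  rw [cond_apply hBm, Set.inter_eq_right.2 hCB, hQB] at h1
  have h2 : Q C ≤ delay μ T ν S / (k + 1) * lawNoChange N B := by
    have hk : ((k : ℝ≥0∞) + 1) ≠ 0 := by simp
    have hk' : ((k : ℝ≥0∞) + 1) ≠ ⊤ := by simp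
    have h3 : (lawNoChange N B)⁻¹ * Q C ≤ delay μ T ν S / (k + 1) := by
      rw [ENNReal.le_div_iff_mul_le (Or.inl hk) (Or.inl hk'), mul_comm]
      exact h1
    calc Q C = (lawNoChange N B)⁻¹ * Q C * lawNoChange N B := by
          rw [mul_right_comm, ENNReal.inv_mul_cancel h0 (measure_ne_top _ _), one_mul]
      _ ≤ _ := by gcongr
  calc lawNoChange N B = Q B := hQB.symm
    _ = Q C + Q (B \ C) := by rw [measure_add_sdiff hCm.nullMeasurableSet,
          Set.union_eq_self_of_subset_left hCB]
    _ ≤ _ := by gcongr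

/-- Where L exceeds c, (L/c)^s ≥ 1. -/
lemma le_add_rpow_mul {c : ℝ} (hc : 0 < c) {s : ℝ} (hs : 0 < s) (L : ℝ≥0∞) :
    L ≤ ENNReal.ofReal c + ENNReal.ofReal (c ^ (-s)) * L ^ (1 + s) := by
  rcases le_total L (ENNReal.ofReal c) with h | h
  · exact h.trans le_self_add
  · refine le_trans ?_ le_add_self
    rw [ENNReal.rpow_add_of_nonneg _ _ zero_le_one hs.le, ENNReal.rpow_one]
    calc L = L * 1 := (mul_one L).symm
      _ = L * (ENNReal.ofReal (c ^ (-s)) * ENNReal.ofReal c ^ s) := by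
          rw [ENNReal.ofReal_rpow_of_pos hc, ← ENNReal.ofReal_mul (by positivity),
            ← Real.rpow_add hc]
          simp
      _ ≤ L * (ENNReal.ofReal (c ^ (-s)) * L ^ s) := by gcongr
      _ = _ := by ring

/-- Nonasymptotic trade-off between the worst-case delay and the average run length. -/
theorem one_le_worstDelay_add (hT : IsStoppingRule T) {γ : ℝ} (hγ : 0 < γ)
    (hARL : ENNReal.ofReal γ ≤ ARL T) (μ : ℝ) {m b : ℕ} [NeZero b] (hmb : m * b ≤ N) (k : ℕ+)
    {s : ℝ} (hs0 : 0 < s) (hs1 : s ≤ 1) {c : ℝ} (hc : 0 < c) :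
    1 ≤ worstDelay μ m T / (k + 1) + (ENNReal.ofReal c * ENNReal.ofReal (2 * k / γ) +
      ENNReal.ofReal (c ^ (-s)) * (1 + ((b : ℝ≥0∞)⁻¹) ^ s *
        ENNReal.ofReal (Real.exp (k * ((s + s ^ 2) * μ ^ 2 / 2)))) ^ m) := by
  obtain ⟨ν, h0, hA⟩ := exists_small_stopping_probability hT hγ hARL k
  set B := {x | ((ν : ℕ) : ℕ∞) ≤ T x} with hB
  set C := {x | ((ν + k : ℕ+) : ℕ∞) ≤ T x} with hC
  set P := lawNoChange N with hP
  have hBm := hT.measurableSet_le ν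
  have hCm := hT.measurableSet_le (ν + k)
  have hAm : MeasurableSet[coordSigma {i : Fin N × ℕ+ | i.2 < ν + k}] (B \ C) := by
    refine MeasurableSet.diff (coordSigma_mono ?_ _ hBm) hCm
    intro i hi
    exact lt_trans hi (PNat.lt_add_right ν k)
  set W := Finset.Ico ν (ν + k) with hW
  have hWc : W.card = k := by simp [hW]
  let e : Fin m × Fin b → Fin N := fun a => Fin.castLE hmb (finProdFinEquiv a)
  have he : Function.Injective e :=
    (Fin.castLE_injective hmb).comp finProdFinEquiv.injective
  have h1 : P B ≤ worstDelay μ m T / (k + 1) * P B +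
      ∫⁻ x in B \ C, mixtureRatio μ W e x ∂P := by
    refine le_setLIntegral_mixtureRatio μ W e _ _ _ fun f => ?_
    have hinj : Function.Injective fun j => e (j, f j) := fun j j' h =>
      (Prod.ext_iff.1 (he h)).1
    let S : Finset (Fin N) := Finset.univ.map ⟨fun j => e (j, f j), hinj⟩
    have hS : S.card = m := by simp [S]
    have h2 := lawNoChange_le_delay_add hT μ ν k S h0
    rw [lawChange_apply μ ν S k hAm] at h2
    simp only [S, Finset.prod_map, Function.Embedding.coeFn_mk] at h2
    refine h2.trans ?_
    gcongr
    exact le_iSup_of_le ν (le_iSup_of_le S (le_iSup_of_le hS le_rfl))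
  have hLm : Measurable[coordSigma {i : Fin N × ℕ+ | i.2 ∈ W}]
      fun x => mixtureRatio μ W e x ^ (1 + s) := (measurable_mixtureRatio μ W e).pow_const _
  have hLm' := hLm.mono (coordSigma_le _) le_rfl
  -- B is decided before ν, while the mixture ratio uses only times in [ν, ν + k).
  have h3 : ∫⁻ x in B, mixtureRatio μ W e x ^ (1 + s) ∂P =
      P B * ∫⁻ x, mixtureRatio μ W e x ^ (1 + s) ∂P := by
    rw [← lintegral_indicator (hT.measurableSet_le' ν), ← lintegral_indicator_one
      (hT.measurableSet_le' ν)]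
    have hd : Disjoint {i : Fin N × ℕ+ | i.2 < ν} {i : Fin N × ℕ+ | i.2 ∈ W} := by
      refine Set.disjoint_left.2 fun i hi hi' => ?_
      exact absurd (Finset.mem_Ico.1 (show i.2 ∈ Finset.Ico ν (ν + k) from hi')).1 (not_le.2 (show i.2 < ν from hi))
    have h1B : Measurable[coordSigma {i : Fin N × ℕ+ | i.2 < ν}]
        (B.indicator (1 : Path N → ℝ≥0∞)) :=
      Measurable.indicator (@measurable_const _ _ _ (coordSigma _) 1) hBm
    have := lintegral_mul_of_disjoint (fun _ : Fin N × ℕ+ => gaussianReal 0 1) hd h1B hLm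
    rw [hP, lawNoChange, law, ← this]
    refine lintegral_congr fun x => ?_
    by_cases hx : x ∈ B
    · rw [Set.indicator_of_mem hx, Set.indicator_of_mem hx, Pi.one_apply, one_mul]
    · rw [Set.indicator_of_notMem hx, Set.indicator_of_notMem hx, zero_mul]
  have h4 : ∫⁻ x in B \ C, mixtureRatio μ W e x ∂P ≤
      (ENNReal.ofReal c * ENNReal.ofReal (2 * k / γ) +
      ENNReal.ofReal (c ^ (-s)) * (1 + ((b : ℝ≥0∞)⁻¹) ^ s *
        ENNReal.ofReal (Real.exp (k * ((s + s ^ 2) * μ ^ 2 / 2)))) ^ m) * P B := by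
    calc ∫⁻ x in B \ C, mixtureRatio μ W e x ∂P
        ≤ ∫⁻ x in B \ C, (ENNReal.ofReal c +
            ENNReal.ofReal (c ^ (-s)) * mixtureRatio μ W e x ^ (1 + s)) ∂P :=
          lintegral_mono fun x => le_add_rpow_mul hc hs0 _
      _ = ENNReal.ofReal c * P (B \ C) + ENNReal.ofReal (c ^ (-s)) *
            ∫⁻ x in B \ C, mixtureRatio μ W e x ^ (1 + s) ∂P := by
          rw [lintegral_add_left measurable_const, setLIntegral_const,
            lintegral_const_mul _ hLm']
      _ ≤ ENNReal.ofReal c * (ENNReal.ofReal (2 * k / γ) * P B) + ENNReal.ofReal (c ^ (-s)) *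
            ∫⁻ x in B, mixtureRatio μ W e x ^ (1 + s) ∂P := by
          gcongr
          exact Set.sdiff_subset
      _ ≤ ENNReal.ofReal c * (ENNReal.ofReal (2 * k / γ) * P B) + ENNReal.ofReal (c ^ (-s)) *
            (P B * (1 + ((b : ℝ≥0∞)⁻¹) ^ s *
              ENNReal.ofReal (Real.exp (k * ((s + s ^ 2) * μ ^ 2 / 2)))) ^ m) := by
          rw [h3]
          gcongr
          refine (lintegral_mixtureRatio_rpow_le μ W he hs0 hs1).trans_eq ?_
          rw [hWc]
      _ = _ := by ring
  refine (ENNReal.mul_le_mul_iff_left h0 (measure_ne_top _ _)).1 ?_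
  rw [one_mul, add_mul]
  exact h1.trans (add_le_add_right h4 _)

end StoppingRule

/-- The trade-off between delay and average run length, in terms of real numbers. -/
lemma one_le_of_worstDelay_le {N : ℕ} {T : Path N → ℕ∞} (hT : IsStoppingRule T) {γ : ℝ}
    (hγ : 0 < γ) (hARL : ENNReal.ofReal γ ≤ ARL T) (μ : ℝ) {m b : ℕ} (hb : 0 < b)
    (hmb : m * b ≤ N) (k : ℕ+) {s : ℝ} (hs0 : 0 < s) (hs1 : s ≤ 1) {d : ℝ} (hd0 : 0 ≤ d)
    (hd : worstDelay μ m T ≤ ENNReal.ofReal d) :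
    1 ≤ d / (k + 1) + (2 * (k * Real.exp (-(Real.log γ / 2))) +
      Real.exp (m * ((b : ℝ) ^ (-s) * Real.exp (k * ((s + s ^ 2) * μ ^ 2 / 2))) -
        s * Real.log γ / 2)) := by
  have : NeZero b := ⟨hb.ne'⟩
  have hb' : (0 : ℝ) < b := by exact_mod_cast hb
  set ℓ := Real.log γ with hℓ
  have hγℓ : γ = Real.exp ℓ := (Real.exp_log hγ).symm
  set M := Real.exp (k * ((s + s ^ 2) * μ ^ 2 / 2)) with hM
  -- The truncation level is √γ.
  have h := one_le_worstDelay_add hT hγ hARL μ hmb k hs0 hs1 (Real.exp_pos (ℓ / 2))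
  have e1 : worstDelay μ m T / ((k : ℝ≥0∞) + 1) ≤ ENNReal.ofReal (d / (k + 1)) := by
    rw [ENNReal.ofReal_div_of_pos (by positivity), ENNReal.ofReal_add (by positivity) zero_le_one,
      ENNReal.ofReal_natCast, ENNReal.ofReal_one]
    gcongr
  have e2 : ENNReal.ofReal (Real.exp (ℓ / 2)) * ENNReal.ofReal (2 * k / γ) =
      ENNReal.ofReal (2 * (k * Real.exp (-(ℓ / 2)))) := by
    rw [← ENNReal.ofReal_mul (Real.exp_pos _).le, hγℓ]
    congr 1
    rw [div_eq_mul_inv (2 * (k : ℝ)), ← Real.exp_neg, mul_left_comm, ← Real.exp_add, mul_assoc]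
    congr 4
    ring
  have e3 : ENNReal.ofReal (Real.exp (ℓ / 2) ^ (-s)) *
      (1 + ((b : ℝ≥0∞)⁻¹) ^ s * ENNReal.ofReal M) ^ m ≤
      ENNReal.ofReal (Real.exp (m * ((b : ℝ) ^ (-s) * M) - s * ℓ / 2)) := by
    have hbs : ((b : ℝ≥0∞)⁻¹) ^ s = ENNReal.ofReal ((b : ℝ) ^ (-s)) := by
      rw [ENNReal.inv_rpow, ← ENNReal.rpow_neg, ← ENNReal.ofReal_natCast,
        ENNReal.ofReal_rpow_of_pos hb']
    rw [hbs, ← ENNReal.ofReal_mul (by positivity), ← ENNReal.ofReal_one,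
      ← ENNReal.ofReal_add zero_le_one (by positivity), ← ENNReal.ofReal_pow (by positivity),
      ← ENNReal.ofReal_mul (by positivity)]
    refine ENNReal.ofReal_le_ofReal ?_
    calc Real.exp (ℓ / 2) ^ (-s) * (1 + (b : ℝ) ^ (-s) * M) ^ m
        ≤ Real.exp (ℓ / 2) ^ (-s) * Real.exp ((b : ℝ) ^ (-s) * M) ^ m := by
          gcongr
          rw [add_comm]
          exact Real.add_one_le_exp _
      _ = _ := by
          rw [← Real.exp_mul, ← Real.exp_nat_mul, ← Real.exp_add]
          congr 1
          ring
  rw [e2] at h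
  have h' := h.trans (add_le_add e1 (add_le_add_right e3 _))
  rw [← ENNReal.ofReal_add (by positivity) (by positivity),
    ← ENNReal.ofReal_add (by positivity) (by positivity), ENNReal.one_le_ofReal] at h'
  exact h'

/-! ### Asymptotics in N and the choice of window and exponent. -/

lemma tendsto_natCast_rpow_atTop {a : ℝ} (ha : 0 < a) :
    Tendsto (fun N : ℕ => (N : ℝ) ^ a) atTop atTop :=
  (tendsto_rpow_atTop ha).comp tendsto_natCast_atTop_atTop

lemma tendsto_natCast_rpow_zero {a : ℝ} (ha : a < 0) :
    Tendsto (fun N : ℕ => (N : ℝ) ^ a) atTop (𝓝 0) := by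
  have h := (tendsto_rpow_neg_atTop (neg_pos.2 ha)).comp tendsto_natCast_atTop_atTop
  simpa [Function.comp_def] using h

lemma tendsto_rpow_mul_exp_neg (a : ℝ) {c q : ℝ} (hc : 0 < c) (hq : 0 < q) :
    Tendsto (fun N : ℕ => (N : ℝ) ^ a * Real.exp (-(c * (N : ℝ) ^ q))) atTop (𝓝 0) := by
  refine ((tendsto_rpow_mul_exp_neg_mul_atTop_nhds_zero (a / q) c hc).comp
    (tendsto_natCast_rpow_atTop hq)).congr fun N => ?_
  simp only [Function.comp_apply]
  rw [← Real.rpow_mul (Nat.cast_nonneg N), mul_div_cancel₀ _ hq.ne', neg_mul]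

lemma tendsto_rpow_sub_rpow_atBot (C : ℝ) {c p q : ℝ} (hc : 0 < c) (hq : 0 < q) (hpq : p < q) :
    Tendsto (fun N : ℕ => C * (N : ℝ) ^ p - c * (N : ℝ) ^ q) atTop atBot := by
  have h1 : Tendsto (fun N : ℕ => C * (N : ℝ) ^ (p - q) - c) atTop (𝓝 (C * 0 - c)) :=
    ((tendsto_natCast_rpow_zero (sub_neg.2 hpq)).const_mul C).sub_const c
  have h2 := (tendsto_natCast_rpow_atTop hq).atTop_mul_neg (by linarith : C * 0 - c < 0) h1
  refine h2.congr' ?_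
  filter_upwards [eventually_gt_atTop 0] with N hN
  have hN' : (0 : ℝ) < N := by exact_mod_cast hN
  rw [mul_sub, mul_left_comm, ← Real.rpow_add hN']
  ring_nf

lemma eventually_bounds_of_isEquivalent_rpow {u : ℕ → ℝ} {a : ℝ}
    (h : u ~[atTop] fun N => (N : ℝ) ^ a) :
    ∀ᶠ N : ℕ in atTop, (N : ℝ) ^ a / 2 ≤ u N ∧ u N ≤ 2 * (N : ℝ) ^ a := by
  obtain ⟨φ, hφ, he⟩ := h.exists_eq_mul
  filter_upwards [he, hφ.eventually (Icc_mem_nhds (by norm_num : (1 / 2 : ℝ) < 1)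
    (by norm_num : (1 : ℝ) < 2))] with N hN hφN
  have hpos : (0 : ℝ) ≤ (N : ℝ) ^ a := by positivity
  rw [hN, Pi.mul_apply]
  constructor
  · nlinarith [hφN.1]
  · nlinarith [hφN.2]

/-- With blocks of size ⌊N/m⌋, one factor 2 pays for the integer part and one for m ≤ 2N^(1-β). -/
lemma eventually_block_bounds {β : ℝ} (hβ0 : 0 < β) (hβ1 : β < 1) {m : ℕ → ℕ}
    (hm : (fun N => (m N : ℝ)) ~[atTop] fun N => (N : ℝ) ^ (1 - β)) :
    ∀ᶠ N : ℕ in atTop, (m N : ℝ) ≤ 2 * (N : ℝ) ^ (1 - β) ∧ 0 < N / m N ∧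
      (N : ℝ) ^ β / 4 ≤ (N / m N : ℕ) := by
  filter_upwards [eventually_bounds_of_isEquivalent_rpow hm, eventually_gt_atTop 0,
    (tendsto_natCast_rpow_atTop hβ0).eventually_ge_atTop 2] with N hmN hN hNβ
  have hN' : (0 : ℝ) < N := by exact_mod_cast hN
  have hpos : (0 : ℝ) < (N : ℝ) ^ (1 - β) := by positivity
  have hprod : (N : ℝ) ^ (1 - β) * (N : ℝ) ^ β = N := by
    rw [← Real.rpow_add hN']
    simp
  have hm0 : 0 < m N := by
    have : (0 : ℝ) < m N := lt_of_lt_of_le (by positivity) hmN.1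
    exact_mod_cast this
  have hmle : m N ≤ N := by
    have : (m N : ℝ) ≤ N := by
      rw [← hprod]
      nlinarith [hmN.2]
    exact_mod_cast this
  have hb : 0 < N / m N := Nat.div_pos hmle hm0
  refine ⟨hmN.2, hb, ?_⟩
  have h1 : N ≤ m N * (2 * (N / m N)) := by
    have := Nat.lt_mul_div_succ N hm0
    nlinarith
  have h2 : (N : ℝ) ≤ m N * (2 * (N / m N : ℕ)) := by exact_mod_cast h1
  have hbr : (0 : ℝ) ≤ (N / m N : ℕ) := Nat.cast_nonneg _
  have h3 : (N : ℝ) ^ (1 - β) * (N : ℝ) ^ β ≤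
      (N : ℝ) ^ (1 - β) * (4 * (N / m N : ℕ)) := by
    rw [hprod]
    nlinarith [hmN.2]
  have := le_of_mul_le_mul_left h3 hpos
  linarith

section Asymptotics

variable {μ β ζ : ℝ} {γ : ℕ → ℝ} {m : ℕ → ℕ} {T : (N : ℕ) → Path N → ℕ∞}

/-- Common to both regimes: a delay at most d would give 1 ≤ θ + o(1) with θ < 1, because the
exponent is at most C N^p - c N^q and p < q. -/
lemma eventually_lt_worstDelay (hζ : 0 < ζ) (hβ0 : 0 < β) (hβ1 : β < 1) (hγ1 : ∀ N, 1 ≤ γ N)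
    (hγ : (fun N => Real.log (γ N)) ~[atTop] fun N => (N : ℝ) ^ ζ)
    (hm : (fun N => (m N : ℝ)) ~[atTop] fun N => (N : ℝ) ^ (1 - β))
    (hT : ∀ N, IsStoppingRule (T N)) (hARL : ∀ N, ENNReal.ofReal (γ N) ≤ ARL (T N))
    {k : ℕ → ℕ+} {s d : ℕ → ℝ} {a C c K p q θ : ℝ} (hs0 : ∀ N, 0 < s N) (hs1 : ∀ N, s N ≤ 1)
    (hd0 : ∀ N, 0 ≤ d N) (hθ : θ < 1) (hc : 0 < c) (hq : 0 < q) (hpq : p < q)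
    (hd : ∀ᶠ N in atTop, d N / (k N + 1) ≤ θ)
    (hk : ∀ᶠ N in atTop, (k N : ℝ) ≤ K * (N : ℝ) ^ a)
    (hM : ∀ᶠ N in atTop, (m N : ℝ) * (((N / m N : ℕ) : ℝ) ^ (-s N) *
      Real.exp (k N * ((s N + s N ^ 2) * μ ^ 2 / 2))) ≤ C * (N : ℝ) ^ p)
    (hs : ∀ᶠ N : ℕ in atTop, c * (N : ℝ) ^ q ≤ s N * (N : ℝ) ^ ζ / 4) :
    ∀ᶠ N in atTop, ENNReal.ofReal (d N) < worstDelay μ (m N) (T N) := by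
  have h1 : Tendsto (fun N : ℕ => θ + (2 * (K * ((N : ℝ) ^ a *
      Real.exp (-(1 / 4 * (N : ℝ) ^ ζ)))) +
      Real.exp (C * (N : ℝ) ^ p - c * (N : ℝ) ^ q))) atTop (𝓝 (θ + (2 * (K * 0) + 0))) :=
    ((((tendsto_rpow_mul_exp_neg a (by norm_num) hζ).const_mul K).const_mul 2).add
      (Real.tendsto_exp_atBot.comp (tendsto_rpow_sub_rpow_atBot C hc hq hpq))).const_add θ
  have h2 := h1.eventually_lt_const (by linarith : θ + (2 * (K * 0) + 0) < 1)
  filter_upwards [h2, hd, hk, hM, hs, eventually_block_bounds hβ0 hβ1 hm,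
    eventually_bounds_of_isEquivalent_rpow hγ] with N h2 hd hk hM hs hb hγN
  by_contra! hcon
  have h := one_le_of_worstDelay_le (hT N) (zero_lt_one.trans_le (hγ1 N)) (hARL N) μ hb.2.1
    (Nat.mul_div_le N (m N)) (k N) (hs0 N) (hs1 N) (hd0 N) hcon
  have e1 : (k N : ℝ) * Real.exp (-(Real.log (γ N) / 2)) ≤
      K * ((N : ℝ) ^ a * Real.exp (-(1 / 4 * (N : ℝ) ^ ζ))) := by
    rw [← mul_assoc]
    refine mul_le_mul hk (Real.exp_le_exp.2 (by linarith [hγN.1])) (Real.exp_pos _).le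
      ((Nat.cast_nonneg _).trans hk)
  have e2 : s N * (N : ℝ) ^ ζ / 4 ≤ s N * Real.log (γ N) / 2 := by
    have := mul_le_mul_of_nonneg_left hγN.1 (hs0 N).le
    linarith
  have e3 := Real.exp_le_exp.2 (sub_le_sub hM (hs.trans e2))
  linarith

/-- `toPNat'` sends 0 to 1, so the upper bound needs `1 ≤ y`. -/
lemma toPNat'_floor {y : ℝ} (hy : 1 ≤ y) :
    ((⌊y⌋₊.toPNat' : ℕ+) : ℝ) ≤ y ∧ y ≤ ((⌊y⌋₊.toPNat' : ℕ+) : ℝ) + 1 := by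
  have h : ((⌊y⌋₊.toPNat' : ℕ+) : ℕ) = ⌊y⌋₊ := by
    rw [Nat.toPNat'_coe, if_pos (Nat.floor_pos.2 hy)]
  rw [h]
  exact ⟨Nat.floor_le (by linarith), (Nat.lt_floor_add_one y).le⟩

lemma rho_pos (h1 : (1 - ζ) / 2 < β) (h2 : β < 1 - ζ) : 0 < rho β ζ := by
  unfold rho
  split_ifs with h
  · linarith
  · have : Real.sqrt (1 - ζ - β) < Real.sqrt (1 - ζ) :=
      Real.sqrt_lt_sqrt (by linarith) (by linarith)
    exact pow_pos (sub_pos.2 this) 2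

/-- The exponent `s` that is optimal for the boundary value `rho`. -/
lemma exists_moment_exponent (h2 : β < 1 - ζ) :
    ∃ s : ℝ, 0 < s ∧ s ≤ 1 ∧ 1 - β - β * s + rho β ζ * (s + s ^ 2) = ζ := by
  unfold rho
  split_ifs with h
  · exact ⟨1, one_pos, le_rfl, by ring⟩
  · push Not at h
    set a := Real.sqrt (1 - ζ) with ha
    set d := Real.sqrt (1 - ζ - β) with hd
    have ha2 : a ^ 2 = 1 - ζ := Real.sq_sqrt (by linarith)
    have hd2 : d ^ 2 = 1 - ζ - β := Real.sq_sqrt (by linarith)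
    have hd0 : 0 < d := Real.sqrt_pos.2 (by linarith)
    have ha0 : 0 ≤ a := Real.sqrt_nonneg _
    -- Equivalent to β ≥ 3(1 - ζ)/4; it makes the exponent chosen below at most 1.
    have hda : 2 * d ≤ a := by
      refine le_of_sq_le_sq ?_ ha0
      nlinarith
    have had : 0 < a - d := by linarith
    -- Solving the equation for its coefficient gives a²/(1 + s) - d²/s, maximal where s/(1 + s) =
    -- d/a, with value (a - d)².
    refine ⟨d / (a - d), by positivity, (div_le_one had).2 (by linarith), ?_⟩
    have hβ : β = a ^ 2 - d ^ 2 := by linarith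
    have hζ : ζ = 1 - a ^ 2 := by linarith
    rw [hβ, hζ]
    field_simp
    ring

/-- The logarithmic regime: delays below `2 μ⁻² ρ log N` are impossible. -/
lemma eventually_log_lt_worstDelay (hμ : 0 < μ) (hζ : 0 < ζ) (hβ0 : 0 < β) (hβ1 : β < 1)
    (hγ1 : ∀ N, 1 ≤ γ N)
    (hγ : (fun N => Real.log (γ N)) ~[atTop] fun N => (N : ℝ) ^ ζ)
    (hm : (fun N => (m N : ℝ)) ~[atTop] fun N => (N : ℝ) ^ (1 - β))
    (hT : ∀ N, IsStoppingRule (T N)) (hARL : ∀ N, ENNReal.ofReal (γ N) ≤ ARL (T N))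
    (h2 : β < 1 - ζ) {x : ℝ} (hx0 : 0 ≤ x)
    (hx : x < 2 / μ ^ 2 * rho β ζ) :
    ∀ᶠ N : ℕ in atTop, ENNReal.ofReal (x * Real.log N) < worstDelay μ (m N) (T N) := by
  -- A window of y log N against a delay of x log N makes the Markov term at most x/y < 1.
  obtain ⟨y, hxy, hy⟩ := exists_between hx
  have hy0 : 0 < y := hx0.trans_lt hxy
  obtain ⟨s, hs0, hs1, hs⟩ := exists_moment_exponent h2
  have hr : y * μ ^ 2 / 2 < rho β ζ := by
    rw [div_mul_eq_mul_div, lt_div_iff₀ (by positivity)] at hy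
    linarith
  have hlog : ∀ᶠ N : ℕ in atTop, 1 ≤ y * Real.log N :=
    ((Real.tendsto_log_atTop.comp tendsto_natCast_atTop_atTop).const_mul_atTop
      hy0).eventually_ge_atTop 1
  refine eventually_lt_worstDelay (k := fun N => ⌊y * Real.log N⌋₊.toPNat') (s := fun _ => s)
    (d := fun N => x * Real.log N) (a := 1) (K := y) (C := 2 * 4 ^ s)
    (p := 1 - β - β * s + y * μ ^ 2 / 2 * (s + s ^ 2)) (c := s / 4) (q := ζ) (θ := x / y)
    hζ hβ0 hβ1 hγ1 hγ hm hT hARL (fun _ => hs0) (fun _ => hs1)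
    (fun N => mul_nonneg hx0 (Real.log_natCast_nonneg N))
    ((div_lt_one hy0).2 hxy) (by positivity) hζ ?_ ?_ ?_ ?_ ?_
  · calc _ < 1 - β - β * s + rho β ζ * (s + s ^ 2) := by gcongr
      _ = ζ := hs
  · filter_upwards [hlog] with N hN
    have h := (toPNat'_floor hN).2
    rw [div_le_div_iff₀ (by positivity) hy0, mul_assoc, mul_comm (Real.log N)]
    gcongr
  · filter_upwards [hlog] with N hN
    refine (toPNat'_floor hN).1.trans ?_
    rw [Real.rpow_one]
    gcongr
    exact Real.log_le_self (Nat.cast_nonneg N)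
  · filter_upwards [hlog, eventually_block_bounds hβ0 hβ1 hm, eventually_gt_atTop 0]
      with N hN hb hN0
    have hN' : (0 : ℝ) < N := by exact_mod_cast hN0
    calc _ ≤ 2 * (N : ℝ) ^ (1 - β) * (((N : ℝ) ^ β / 4) ^ (-s) *
          Real.exp (y * Real.log N * ((s + s ^ 2) * μ ^ 2 / 2))) := by
          refine mul_le_mul hb.1 ?_ (by positivity) (by positivity)
          refine mul_le_mul ?_ ?_ (by positivity) (by positivity)
          · exact Real.rpow_le_rpow_of_nonpos (by positivity) hb.2.2 (by linarith)
          · have := (toPNat'_floor hN).1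
            gcongr
      _ = _ := by
          have e1 : Real.exp (y * Real.log N * ((s + s ^ 2) * μ ^ 2 / 2)) =
              (N : ℝ) ^ (y * μ ^ 2 / 2 * (s + s ^ 2)) := by
            rw [Real.rpow_def_of_pos hN']
            congr 1
            ring
          have e2 : ((N : ℝ) ^ β / 4) ^ (-s) = (N : ℝ) ^ (-(β * s)) * 4 ^ s := by
            rw [Real.div_rpow (by positivity) (by norm_num), ← Real.rpow_mul hN'.le,
              Real.rpow_neg (by norm_num : (0 : ℝ) ≤ 4), div_inv_eq_mul]
            ring_nf
          rw [e1, e2, Real.rpow_add hN', sub_eq_add_neg (1 - β), Real.rpow_add hN']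
          ring
  · exact Eventually.of_forall fun N => (div_mul_eq_mul_div _ _ _).le

/-- The polynomial regime: delays below `N ^ (β + ζ - 1)` are impossible. -/
lemma eventually_rpow_lt_worstDelay (hζ : 0 < ζ) (hβ0 : 0 < β) (hβ1 : β < 1)
    (hγ1 : ∀ N, 1 ≤ γ N)
    (hγ : (fun N => Real.log (γ N)) ~[atTop] fun N => (N : ℝ) ^ ζ)
    (hm : (fun N => (m N : ℝ)) ~[atTop] fun N => (N : ℝ) ^ (1 - β))
    (hT : ∀ N, IsStoppingRule (T N)) (hARL : ∀ N, ENNReal.ofReal (γ N) ≤ ARL (T N))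
    {x : ℝ} (hx0 : 0 ≤ x) (hx : x < β + ζ - 1) :
    ∀ᶠ N : ℕ in atTop, ENNReal.ofReal ((N : ℝ) ^ x) < worstDelay μ (m N) (T N) := by
  obtain ⟨y, hxy, hy⟩ := exists_between hx
  have hy0 : 0 < y := hx0.trans_lt hxy
  have hpow : ∀ᶠ N : ℕ in atTop, 1 ≤ (N : ℝ) ^ y :=
    (tendsto_natCast_rpow_atTop hy0).eventually_ge_atTop 1
  have hk1 : ∀ k : ℕ+, (1 : ℝ) ≤ k := fun k => by exact_mod_cast k.pos
  -- With s = 1/k, k(s + s²)μ²/2 ≤ μ², and b^(-s) ≤ 1 suffices.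
  refine eventually_lt_worstDelay (k := fun N => ⌊(N : ℝ) ^ y⌋₊.toPNat')
    (s := fun N => 1 / ((⌊(N : ℝ) ^ y⌋₊.toPNat' : ℕ+) : ℝ))
    (d := fun N => (N : ℝ) ^ x) (a := y) (K := 1) (C := 2 * Real.exp (μ ^ 2))
    (p := 1 - β) (c := 1 / 4) (q := ζ - y) (θ := 1 / 2)
    hζ hβ0 hβ1 hγ1 hγ hm hT hARL
    (fun N => by have := hk1 (⌊(N : ℝ) ^ y⌋₊.toPNat'); positivity)
    (fun N => div_le_one_of_le₀ (hk1 _) (Nat.cast_nonneg _))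
    (fun N => by positivity) (by norm_num) (by norm_num) (by linarith) (by linarith)
    ?_ ?_ ?_ ?_
  · filter_upwards [hpow, eventually_gt_atTop 0,
      (tendsto_natCast_rpow_zero (sub_neg.2 hxy)).eventually_le_const
        (by norm_num : (0 : ℝ) < 1 / 2)] with N hN hN0 hh
    have hN' : (0 : ℝ) < N := by exact_mod_cast hN0
    rw [div_le_iff₀ (by positivity)]
    calc (N : ℝ) ^ x = (N : ℝ) ^ (x - y) * (N : ℝ) ^ y := by
          rw [← Real.rpow_add hN']
          simp
      _ ≤ _ := mul_le_mul hh (toPNat'_floor hN).2 (by positivity) (by norm_num)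
  · filter_upwards [hpow] with N hN
    rw [one_mul]
    exact (toPNat'_floor hN).1
  · filter_upwards [eventually_block_bounds hβ0 hβ1 hm] with N hb
    set k : ℕ+ := ⌊(N : ℝ) ^ y⌋₊.toPNat' with hk
    have hk0 := hk1 k
    have hk' : (0 : ℝ) < k := by linarith
    rw [mul_right_comm]
    refine mul_le_mul hb.1 ?_ (by positivity) (by positivity)
    rw [← one_mul (Real.exp (μ ^ 2))]
    refine mul_le_mul ?_ (Real.exp_le_exp.2 ?_) (by positivity) zero_le_one
    · exact Real.rpow_le_one_of_one_le_of_nonpos (by exact_mod_cast hb.2.1)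
        (neg_nonpos.2 (by positivity))
    · have e : (k : ℝ) * ((1 / (k : ℝ) + (1 / (k : ℝ)) ^ 2) * μ ^ 2 / 2) =
          (1 + 1 / k) * μ ^ 2 / 2 := by
        field_simp
      rw [e]
      have : (1 : ℝ) / k ≤ 1 := div_le_one_of_le₀ hk0 hk'.le
      nlinarith [sq_nonneg μ]
  · filter_upwards [hpow, eventually_gt_atTop 0] with N hN hN0
    have hN' : (0 : ℝ) < N := by exact_mod_cast hN0
    have hk0 := hk1 (⌊(N : ℝ) ^ y⌋₊.toPNat')
    have h1 := one_div_le_one_div_of_le (by linarith) (toPNat'_floor hN).1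
    rw [Real.rpow_sub hN']
    have h2 := mul_le_mul_of_nonneg_right h1 (by positivity : (0 : ℝ) ≤ (N : ℝ) ^ ζ)
    rw [one_div_mul_eq_div] at h2
    linarith

end Asymptotics

/-- Since the target is positive, only nonnegative thresholds need testing, as the regime lemmas
require. -/
lemma coe_le_of_forall_nonneg_lt {a : ℝ} (ha : 0 < a) {y : EReal}
    (h : ∀ x : ℝ, 0 ≤ x → x < a → (x : EReal) ≤ y) : (a : EReal) ≤ y := by
  refine le_of_forall_lt fun c hc => ?_
  obtain ⟨x, hcx, hxa⟩ := EReal.lt_iff_exists_real_btwn.1 hc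
  have hxa' : x < a := EReal.coe_lt_coe_iff.1 hxa
  exact hcx.trans_le ((EReal.coe_le_coe_iff.2 (le_max_left x 0)).trans
    (h _ (le_max_right x 0) (max_lt hxa' ha)))

end MultiStream

theorem theoremB (μ β ζ : ℝ) (hμ : 0 < μ) (hζ : 0 < ζ) (hβ0 : 0 < β) (hβ1 : β < 1)
    (γ : ℕ → ℝ) (hγ1 : ∀ N, 1 ≤ γ N)
    (hγ : (fun N => Real.log (γ N)) ~[atTop] fun N => (N : ℝ) ^ ζ)
    (m : ℕ → ℕ) (hm : (fun N => (m N : ℝ)) ~[atTop] fun N => (N : ℝ) ^ (1 - β))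
    (T : (N : ℕ) → MultiStream.Path N → ℕ∞)
    (hT : ∀ N, MultiStream.IsStoppingRule (T N))
    (hARL : ∀ N, ENNReal.ofReal (γ N) ≤ MultiStream.ARL (T N)) :
    ((1 - ζ) / 2 < β → β < 1 - ζ →
      ((2 / μ ^ 2 * MultiStream.rho β ζ : ℝ) : EReal) ≤
        liminf (fun N : ℕ =>
          ((MultiStream.worstDelay μ (m N) (T N) : ℝ≥0∞) : EReal) /
            ((Real.log (N : ℝ) : ℝ) : EReal)) atTop) ∧
    (1 - ζ < β →
      ((β + ζ - 1 : ℝ) : EReal) ≤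
        liminf (fun N : ℕ =>
          ENNReal.log (MultiStream.worstDelay μ (m N) (T N)) /
            ((Real.log (N : ℝ) : ℝ) : EReal)) atTop) := by
  have hlog : ∀ᶠ N : ℕ in atTop, 0 < Real.log N :=
    (Real.tendsto_log_atTop.comp tendsto_natCast_atTop_atTop).eventually_gt_atTop 0
  constructor
  · intro h1 h2
    have hρ := MultiStream.rho_pos h1 h2
    refine MultiStream.coe_le_of_forall_nonneg_lt (by positivity) fun x hx0 hx => ?_
    refine le_liminf_of_le (by isBoundedDefault) ?_
    filter_upwards [hlog, MultiStream.eventually_log_lt_worstDelay hμ hζ hβ0 hβ1 hγ1 hγ hm hT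
      hARL h2 hx0 hx] with N hN hD
    rw [EReal.le_div_iff_mul_le (by exact_mod_cast hN) (EReal.coe_ne_top _), ← EReal.coe_mul]
    have := EReal.coe_ennreal_le_coe_ennreal_iff.2 hD.le
    rwa [EReal.coe_ennreal_ofReal, max_eq_left (by positivity)] at this
  · intro h1
    refine MultiStream.coe_le_of_forall_nonneg_lt (by linarith) fun x hx0 hx => ?_
    refine le_liminf_of_le (by isBoundedDefault) ?_
    filter_upwards [hlog, eventually_gt_atTop 0,
      MultiStream.eventually_rpow_lt_worstDelay (μ := μ) hζ hβ0 hβ1 hγ1 hγ hm hT hARL hx0 hx]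
      with N hN hN0 hD
    have hN' : (0 : ℝ) < N := by exact_mod_cast hN0
    rw [EReal.le_div_iff_mul_le (by exact_mod_cast hN) (EReal.coe_ne_top _), ← EReal.coe_mul]
    have := ENNReal.log_monotone hD.le
    rwa [ENNReal.log_ofReal_of_pos (by positivity), Real.log_rpow hN'] at this
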